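/- **Definitions.** A *fibred system* $(X,T,\alpha)$ consists of a standard Borel space $(X,\mathcal B)$, a measurable map $T:X\to X$, and a finite or countable partition $\alpha\subset\mathcal B$ of $X$ such that the sets $T^{-i}A$ ($i\ge 0$, $A\in\alpha$) generate $\mathcal B$ and, for every $A\in\alpha$, $T|_A:A\to TA$ is invertible and bi-measurable. It is *full* if $TA=X$ for all $A\in\alpha$. Cylinders are the sets $[a_0,\dots,a_{n-1}]=\bigcap_{j<n}T^{-j}a_j$ with $a_j\in\alpha$, and $X$ carries the topology generated by the cylinders. The *exchangeable relation* $\mathcal E(X,T,\alpha)$ is the set of pairs $(x,y)$ whose codings $\pi(x),\pi(y)\in\alpha^{\mathbb N}$ (given by $T^nx\in\pi(x)_n\in\alpha$ for $n\ge 0$) differ by a permutation of the indices that moves only finitely many indices. A measure $\mu$ on $X$ is *$\mathcal E(X,T,\alpha)$-invariant* (exchangeable) if $\mu(\kappa(C))=\mu(C)$ for every bi-measurable bijection $\kappa:A\to B$ between sets $A,B\in\mathcal B$ with $(x,\kappa(x))\in\mathcal E(X,T,\alpha)$ for all $x\in A$, and every measurable $C\subseteq A$. A measure $\mu$ is *locally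 finite* on a Borel set $Y\subseteq X$ if $Y$ has a countable cover by relatively open subsets of finite $\mu$-measure; it is *locally finite* if it is so on $Y=X$, and *topologically $\sigma$-finite* if it is so on some Borel set of full $\mu$-measure. It is *recurrent* if for every $a\in\alpha$ one has $N_a:=\sum_{n\ge 0}1_a\circ T^n\in\{0,\infty\}$ $\mu$-almost everywhere. A probability measure $m$ on $X$ is a *$(X,T,\alpha)$-product measure* if $m\big(\bigcap_{j=0}^{n}T^{-j}A_j\big)=\prod_{j=0}^{n}m(A_j)$ for all $n\ge 0$ and $A_0,\dots,A_n\in\alpha$. Finally, $\mu$ is a *mixture of $(X,T,\alpha)$-product probability measures* if there are a measure space $(\Omega,\mathcal F,\nu)$ with $\nu$ $\sigma$-finite (possibly $\nu(\Omega)=\infty$) and $(X,T,\alpha)$-product probability measures $\mu_\omega$ ($\omega\in\Omega$) such that, for every $B\in\mathcal B$, $\omega\mapsto\mu_\omega(B)$ is measurable and $\mu(B)=\int_\Omega\mu_\omega(B)\,d\nu(\omega)$. **Proposition 2.2.** Let $(X,T,\alpha)$ be a full fibred system and let $\mu$ be a $\sigma$-finite, $\mathcal E(X,T,\alpha)$-invariant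 measure on $X$. 1. If $\mu$ is topologically $\sigma$-finite and recurrent, then $\mu$ is a mixture of $(X,T,\alpha)$-product probability measures. 2. If $\mu$ is locally finite, then $\mu$ is recurrent and is a mixture of $(X,T,\alpha)$-product probability measures. -/

import Mathlib

open MeasureTheory ProbabilityTheory
open scoped ENNReal Topology

namespace Fibred

universe u

variable {X : Type u}

/-- The cylinder `[a₀, …, a_{n-1}] = ⋂_{j < n} T⁻ʲ a_j`. -/
def cyl (T : X → X) {n : ℕ} (a : Fin n → Set X) : Set X :=
  ⋂ j : Fin n, T^[(j : ℕ)] ⁻¹' a j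

/-- The triple `(X, T, α)` is a (measurable) fibred system; the standardness of the measurable
space `X` is part of the definition and enters as a type class. -/
structure IsFibredSystem [MeasurableSpace X] [StandardBorelSpace X]
    (T : X → X) (α : Set (Set X)) : Prop where
  measurable_map : Measurable T
  countable : α.Countable
  measurableSet : ∀ A ∈ α, MeasurableSet A
  isPartition : Setoid.IsPartition α
  /-- The partitions `T⁻ⁱ α` (`i ≥ 0`) together generate the σ-algebra of `X`. -/
  generates : ‹MeasurableSpace X› =
    MeasurableSpace.generateFrom {B | ∃ i : ℕ, ∃ A ∈ α, B = T^[i] ⁻¹' A}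
  /-- `T : A → T A` is invertible. -/
  injOn : ∀ A ∈ α, Set.InjOn T A
  /-- The inverse of `T : A → T A` is measurable (and `T A` is a measurable set). -/
  measurableSet_image : ∀ A ∈ α, ∀ B ⊆ A, MeasurableSet B → MeasurableSet (T '' B)

/-- The fibred system is full: every element of `α` is mapped onto `X`. -/
def IsFull (T : X → X) (α : Set (Set X)) : Prop :=
  ∀ A ∈ α, T '' A = Set.univ

/-- The topology of a fibred system: the one generated by the cylinders. -/
@[reducible] def cylinderTopology (T : X → X) (α : Set (Set X)) : TopologicalSpace X :=
  TopologicalSpace.generateFrom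
    {C | ∃ (n : ℕ) (a : Fin n → Set X), (∀ j, a j ∈ α) ∧ C = cyl T a}

/-- The element of the partition `α` that contains `x`. -/
def atom (α : Set (Set X)) (x : X) : Set X :=
  ⋃₀ {A | A ∈ α ∧ x ∈ A}

/-- The coding map `π : X → α^ℕ`, with `Tⁿ x ∈ π(x)ₙ ∈ α`. -/
def coding (T : X → X) (α : Set (Set X)) (x : X) (n : ℕ) : Set X :=
  atom α (T^[n] x)

/-- The exchangeable relation: the codings of `x` and `y` differ by a permutation of the index
set that moves only finitely many indices. -/
def exchangeableRel (T : X → X) (α : Set (Set X)) (x y : X) : Prop :=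
  ∃ σ : Equiv.Perm ℕ, {n | σ n ≠ n}.Finite ∧ ∀ n, coding T α y n = coding T α x (σ n)

/-- `κ : A → B` is a holonomy of the relation `R`: a bi-measurable bijection between measurable
sets `A` and `B` with `(x, κ x) ∈ R` for `x ∈ A`. Values of `κ` outside `A` play no role. -/
structure IsHolonomy [MeasurableSpace X] (R : X → X → Prop) (A B : Set X) (κ : X → X) :
    Prop where
  measurableSet_dom : MeasurableSet A
  measurableSet_im : MeasurableSet B
  bijOn : Set.BijOn κ A B
  measurableSet_preimage : ∀ C ⊆ B, MeasurableSet C → MeasurableSet (A ∩ κ ⁻¹' C)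
  measurableSet_image : ∀ C ⊆ A, MeasurableSet C → MeasurableSet (κ '' C)
  rel : ∀ x ∈ A, R x (κ x)

/-- The measure `μ` is `R`-invariant: `μ ∘ κ = μ` on the domain of every holonomy `κ` of `R`. -/
def IsInvariant [MeasurableSpace X] (R : X → X → Prop) (μ : Measure X) : Prop :=
  ∀ (A B : Set X) (κ : X → X), IsHolonomy R A B κ →
    ∀ C ⊆ A, MeasurableSet C → μ (κ '' C) = μ C

/-- `μ` is locally finite on `Y`: there is a countable cover of `Y` by relatively open subsets
`Y ∩ U` of finite measure. -/
def IsLocallyFiniteOn [MeasurableSpace X] (τ : TopologicalSpace X) (μ : Measure X)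
    (Y : Set X) : Prop :=
  ∃ 𝒰 : Set (Set X), 𝒰.Countable ∧ (∀ U ∈ 𝒰, IsOpen[τ] U ∧ μ (Y ∩ U) < ∞) ∧ Y ⊆ ⋃₀ 𝒰

/-- `μ` is locally finite: locally finite on the whole space. -/
def IsLocallyFinite [MeasurableSpace X] (τ : TopologicalSpace X) (μ : Measure X) : Prop :=
  IsLocallyFiniteOn τ μ Set.univ

/-- `μ` is topologically σ-finite: locally finite on some measurable set of full measure. -/
def IsTopologicallySigmaFinite [MeasurableSpace X] (τ : TopologicalSpace X) (μ : Measure X) :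
    Prop :=
  ∃ Y : Set X, MeasurableSet Y ∧ μ Yᶜ = 0 ∧ IsLocallyFiniteOn τ μ Y

/-- `N_A(x) = ∑_{n ≥ 0} 1_A(Tⁿ x)`, the number of visits of the orbit of `x` to `A`. -/
noncomputable def visits (T : X → X) (A : Set X) (x : X) : ℝ≥0∞ :=
  ∑' n : ℕ, A.indicator (fun _ => (1 : ℝ≥0∞)) (T^[n] x)

/-- `μ` is recurrent: for each `A ∈ α`, almost surely `N_A ∈ {0, ∞}`. -/
def IsRecurrent [MeasurableSpace X] (T : X → X) (α : Set (Set X)) (μ : Measure X) : Prop :=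
  ∀ A ∈ α, ∀ᵐ x ∂μ, visits T A x = 0 ∨ visits T A x = ∞

/-- `m` is a `(X, T, α)`-product probability measure. -/
def IsProductMeasure [MeasurableSpace X] (T : X → X) (α : Set (Set X)) (m : Measure X) : Prop :=
  IsProbabilityMeasure m ∧
    ∀ (n : ℕ) (a : Fin n → Set X), (∀ j, a j ∈ α) → m (cyl T a) = ∏ j, m (a j)

/-- `μ` is a mixture, over a σ-finite (possibly infinite) measure space `(Ω, ν)`, of measures
with the property `P`. A `Kernel Ω X` is a family of measures on `X` that depends measurably
on `ω : Ω`. -/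
def IsMixtureOf [MeasurableSpace X] (P : Measure X → Prop) (μ : Measure X) : Prop :=
  ∃ (Ω : Type u) (_ : MeasurableSpace Ω) (ν : Measure Ω) (κ : Kernel Ω X),
    SigmaFinite ν ∧ (∀ ω, P (κ ω)) ∧
      ∀ B : Set X, MeasurableSet B → μ B = ∫⁻ ω, κ ω B ∂ν

end Fibred

/-! The argument is de Finetti's theorem through Radon–Nikodym derivatives, with infinite measures
reduced to finite ones. By fullness, replacing an initial word by a permutation of it is a holonomy,
so the measure of `prepend T u B` depends only on the multiset of letters of `u`.

For a finite exchangeable `P`, both `P` and the law of what follows a letter `a` are shift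
invariant, so the density `θ a` of the latter with respect to `P` is shift invariant too. Iterating,
the law of what follows `u` has density `∏ a ∈ u, θ a` (`afterWord_eq_withDensity`). Conditionally
on `θ` the letters are therefore independent with law `θ`, and disintegrating over `θ` gives product
measures (`exists_kernel`).

For infinite `μ`, what follows a word of finite measure has a finite exchangeable law. A weighted
sum `P` of these laws is compared with `μ`: since words commute, after each such word `P` has
density `H = ∑ v, c v * ∏ a ∈ v, θ a` with respect to `μ`. As `H` is shift invariant, `μ = H⁻¹ P`
(`exists_eq_withDensity`). Recurrence gives `H > 0` and keeps orbits inside cylinders of finite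
measure.

Local finiteness implies recurrence because a single visit to `a` could be moved to infinitely many
times with equal probability inside one set of finite measure. -/

namespace Fibred

/-! ### Words and cylinders -/

section Words

variable {X : Type*} {T : X → X} {α : Set (Set X)}

/-- The set of all points whose coding is the word `u` followed by the coding of a point of `B`. -/
def prepend (T : X → X) : List α → Set X → Set X
  | [], B => B
  | a :: u, B => (a : Set X) ∩ T ⁻¹' prepend T u B

@[simp] lemma prepend_nil (B : Set X) : prepend T ([] : List α) B = B := rfl

lemma prepend_cons (a : α) (u : List α) (B : Set X) :
    prepend T (a :: u) B = (a : Set X) ∩ T ⁻¹' prepend T u B := rfl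

lemma prepend_append (u v : List α) (B : Set X) :
    prepend T (u ++ v) B = prepend T u (prepend T v B) := by
  induction u with
  | nil => rfl
  | cons a u ih => simp [prepend_cons, ih]

lemma prepend_eq_inter (u : List α) (B : Set X) :
    prepend T u B = prepend T u Set.univ ∩ T^[u.length] ⁻¹' B := by
  induction u with
  | nil => simp
  | cons a u ih =>
    rw [prepend_cons, ih, prepend_cons, List.length_cons, Function.iterate_succ,
      Set.preimage_inter, ← Set.preimage_comp, Set.inter_assoc]

lemma mem_prepend {u : List α} {B : Set X} {x : X} :
    x ∈ prepend T u B ↔ x ∈ prepend T u Set.univ ∧ T^[u.length] x ∈ B := by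
  rw [prepend_eq_inter]; rfl

lemma prepend_mono (u : List α) {B C : Set X} (h : B ⊆ C) : prepend T u B ⊆ prepend T u C := by
  rw [prepend_eq_inter, prepend_eq_inter u C]
  exact Set.inter_subset_inter_right _ (Set.preimage_mono h)

lemma prepend_disjoint (u : List α) {B C : Set X} (h : Disjoint B C) :
    Disjoint (prepend T u B) (prepend T u C) := by
  rw [prepend_eq_inter, prepend_eq_inter u C]
  exact ((h.preimage _).inter_left' _).inter_right' _

lemma cyl_eq_prepend {n : ℕ} (a : Fin n → α) :
    cyl T (fun j => (a j : Set X)) = prepend T (List.ofFn a) Set.univ := by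
  induction n with
  | zero => simp [cyl]
  | succ n ih =>
    rw [List.ofFn_succ, prepend_cons, ← ih]
    ext x
    simp [cyl, Fin.forall_fin_succ]

lemma coding_add (x : X) (m n : ℕ) : coding T α x (m + n) = coding T α (T^[n] x) m := by
  rw [coding, coding, Function.iterate_add_apply]

variable [MeasurableSpace X] [StandardBorelSpace X]

lemma IsFibredSystem.measurableSet_prepend (hfib : IsFibredSystem T α)
    (u : List α) {B : Set X} (hB : MeasurableSet B) :
    MeasurableSet (prepend T u B) := by
  induction u with
  | nil => exact hB
  | cons a u ih => exact (hfib.measurableSet a a.2).inter (hfib.measurable_map ih)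

lemma IsFibredSystem.exists_letter (hfib : IsFibredSystem T α)
    (x : X) : ∃ a : α, x ∈ (a : Set X) := by
  obtain ⟨a, ⟨ha, hx⟩, -⟩ := hfib.isPartition.2 x
  exact ⟨⟨a, ha⟩, hx⟩

lemma IsFibredSystem.letter_unique (hfib : IsFibredSystem T α)
    {x : X} {a b : α} (ha : x ∈ (a : Set X))
    (hb : x ∈ (b : Set X)) : a = b :=
  Subtype.ext ((hfib.isPartition.2 x).unique ⟨a.2, ha⟩ ⟨b.2, hb⟩)

lemma IsFibredSystem.iUnion_letter (hfib : IsFibredSystem T α)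
    : (⋃ a : α, (a : Set X)) = Set.univ :=
  Set.eq_univ_of_forall fun x => Set.mem_iUnion.2 (hfib.exists_letter x)

lemma IsFibredSystem.pairwise_disjoint_letter (hfib : IsFibredSystem T α) :
    Pairwise (Function.onFun Disjoint fun a : α => (a : Set X)) := fun _ _ hab =>
  Set.disjoint_left.2 fun _ ha hb => hab (hfib.letter_unique ha hb)

lemma IsFibredSystem.exists_word (hfib : IsFibredSystem T α) (n : ℕ) (x : X) :
    ∃ u : List α, u.length = n ∧ x ∈ prepend T u Set.univ := by
  induction n generalizing x with
  | zero => exact ⟨[], rfl, trivial⟩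
  | succ n ih =>
    obtain ⟨a, ha⟩ := hfib.exists_letter x
    obtain ⟨u, hu, hx⟩ := ih (T x)
    exact ⟨a :: u, by simp [hu], ha, hx⟩

/-- Cylinders with a common point are nested. -/
lemma IsFibredSystem.prefix_of_mem (hfib : IsFibredSystem T α)
    {u v : List α} {x : X} (hu : x ∈ prepend T u Set.univ)
    (hv : x ∈ prepend T v Set.univ) (h : u.length ≤ v.length) : u <+: v := by
  induction u generalizing v x with
  | nil => exact List.nil_prefix
  | cons a u ih =>
    cases v with
    | nil => simp at h
    | cons b v =>
      obtain rfl := hfib.letter_unique hu.1 hv.1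
      exact List.cons_prefix_cons.2 ⟨rfl, ih hu.2 hv.2 (by simpa using h)⟩

/-- Every neighbourhood of `x` contains a cylinder around `x`. -/
lemma IsFibredSystem.exists_prepend_subset (hfib : IsFibredSystem T α)
    {O : Set X} (hO : IsOpen[cylinderTopology T α] O)
    {x : X} (hx : x ∈ O) :
    ∃ N : ℕ, ∀ u : List α, N ≤ u.length → x ∈ prepend T u Set.univ →
      prepend T u Set.univ ⊆ O := by
  induction hO with
  | basic s hs =>
    obtain ⟨n, a, ha, rfl⟩ := hs
    have h := cyl_eq_prepend (T := T) (fun j => (⟨a j, ha j⟩ : α))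
    simp only at h
    rw [h] at hx ⊢
    refine ⟨n, fun u hu hxu => ?_⟩
    obtain ⟨w, rfl⟩ := hfib.prefix_of_mem hx hxu (by simpa using hu)
    rw [prepend_append]
    exact prepend_mono _ (Set.subset_univ _)
  | univ => exact ⟨0, fun _ _ _ => Set.subset_univ _⟩
  | inter s t _ _ hs ht =>
    obtain ⟨N, hN⟩ := hs hx.1
    obtain ⟨M, hM⟩ := ht hx.2
    exact ⟨max N M, fun u hu hxu => Set.subset_inter
      (hN u (le_of_max_le_left hu) hxu) (hM u (le_of_max_le_right hu) hxu)⟩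
  | sUnion S _ ih =>
    obtain ⟨s, hs, hxs⟩ := hx
    obtain ⟨N, hN⟩ := ih s hs hxs
    exact ⟨N, fun u hu hxu => (hN u hu hxu).trans (Set.subset_sUnion_of_mem hs)⟩

/-- Two finite measures agreeing on cylinders are equal. -/
lemma IsFibredSystem.ext_of_prepend (hfib : IsFibredSystem T α)
    {μ ν : Measure X} [IsFiniteMeasure μ]
    (h : ∀ u : List α, μ (prepend T u Set.univ) = ν (prepend T u Set.univ)) : μ = ν := by
  have := hfib.countable.to_subtype
  -- Cylinders are nested or disjoint, so with `∅` they form a π-system; the empty word compares the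
  -- total masses.
  refine ext_of_generate_finite ({∅} ∪ Set.range fun u : List α => prepend T u Set.univ)
    (le_antisymm ?_ ?_) ?_ ?_ (h [])
  · conv_lhs => rw [hfib.generates]
    refine MeasurableSpace.generateFrom_le ?_
    rintro _ ⟨i, A, hA, rfl⟩
    have : T^[i] ⁻¹' A = ⋃ u : {u : List α // u.length = i},
        prepend T (u.1 ++ [⟨A, hA⟩]) Set.univ := by
      ext x
      simp only [Set.mem_preimage, Set.mem_iUnion, prepend_append, Subtype.exists]
      constructor
      · intro hx
        obtain ⟨u, hu, hxu⟩ := hfib.exists_word i x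
        exact ⟨u, hu, mem_prepend.2 ⟨hxu, by rw [hu]; exact ⟨hx, trivial⟩⟩⟩
      · rintro ⟨u, hu, hxu⟩
        have := (mem_prepend.1 hxu).2.1
        rwa [hu] at this
    rw [this]
    exact MeasurableSet.iUnion fun u =>
      MeasurableSpace.measurableSet_generateFrom (Or.inr ⟨_, rfl⟩)
  · refine MeasurableSpace.generateFrom_le ?_
    rintro _ (rfl | ⟨u, rfl⟩)
    · exact MeasurableSet.empty
    · exact hfib.measurableSet_prepend u MeasurableSet.univ
  · rintro _ (rfl | ⟨u, rfl⟩) _ (rfl | ⟨v, rfl⟩) ⟨x, hx, hx'⟩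
    · exact hx.elim
    · exact hx.elim
    · exact hx'.elim
    · right
      simp only at hx hx' ⊢
      rcases le_total u.length v.length with hl | hl
      · obtain ⟨w, rfl⟩ := hfib.prefix_of_mem hx hx' hl
        exact ⟨_, (Set.inter_eq_right.2 (by
          simp only [prepend_append]; exact prepend_mono _ (Set.subset_univ _))).symm⟩
      · obtain ⟨w, rfl⟩ := hfib.prefix_of_mem hx' hx hl
        exact ⟨_, (Set.inter_eq_left.2 (by
          simp only [prepend_append]; exact prepend_mono _ (Set.subset_univ _))).symm⟩
  · rintro _ (rfl | ⟨u, rfl⟩)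
    · simp
    · exact h u

lemma IsFibredSystem.measure_eq_tsum (hfib : IsFibredSystem T α)
    (μ : Measure X) {B : Set X} (hB : MeasurableSet B) :
    μ B = ∑' a : α, μ ((a : Set X) ∩ B) := by
  have := hfib.countable.to_subtype
  rw [← measure_iUnion
    (fun a b hab => ((hfib.pairwise_disjoint_letter hab).inter_left _).inter_right _)
    (fun a => (hfib.measurableSet a a.2).inter hB), ← Set.iUnion_inter, hfib.iUnion_letter,
    Set.univ_inter]

lemma IsFibredSystem.coding_eq (hfib : IsFibredSystem T α) {x : X} {n : ℕ} {a : α}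
    (h : T^[n] x ∈ (a : Set X)) : coding T α x n = a := by
  have : {A | A ∈ α ∧ T^[n] x ∈ A} = {(a : Set X)} := by
    ext A
    constructor
    · rintro ⟨hA, hx⟩
      exact congrArg Subtype.val (hfib.letter_unique (a := ⟨A, hA⟩) hx h)
    · rintro rfl
      exact ⟨a.2, h⟩
  rw [coding, atom, this, Set.sUnion_singleton]

lemma IsFibredSystem.coding_getElem (hfib : IsFibredSystem T α) {u : List α} {x : X}
    (hx : x ∈ prepend T u Set.univ) {n : ℕ} (hn : n < u.length) :
    coding T α x n = u[n] := by
  induction u generalizing x n with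
  | nil => simp at hn
  | cons a u ih =>
    cases n with
    | zero => exact hfib.coding_eq hx.1
    | succ n =>
      rw [coding_add]
      exact ih hx.2 (by simpa using hn)

lemma IsFibredSystem.exchangeableRel_swap (hfib : IsFibredSystem T α) {p : List α} {a b : α}
    {x y : X} (hx : x ∈ prepend T (p ++ [a, b]) Set.univ)
    (hy : y ∈ prepend T (p ++ [b, a]) Set.univ)
    (hxy : T^[p.length + 2] x = T^[p.length + 2] y) : exchangeableRel T α x y := by
  refine ⟨Equiv.swap p.length (p.length + 1),
    (Set.toFinite {p.length, p.length + 1}).subset fun n hn => ?_, fun n => ?_⟩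
  · by_contra h
    simp only [Set.mem_insert_iff, Set.mem_singleton_iff, not_or] at h
    exact hn (Equiv.swap_apply_of_ne_of_ne h.1 h.2)
  · rcases lt_trichotomy n p.length with h | rfl | h
    · rw [Equiv.swap_apply_of_ne_of_ne (by omega) (by omega),
        hfib.coding_getElem hx (by simp; omega), hfib.coding_getElem hy (by simp; omega),
        List.getElem_append_left h, List.getElem_append_left h]
    · rw [Equiv.swap_apply_left,
        hfib.coding_getElem hx (by simp), hfib.coding_getElem hy (by simp)]
      simp
    · rcases Nat.eq_or_lt_of_le (Nat.succ_le_of_lt h) with rfl | h'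
      · rw [Equiv.swap_apply_right,
          hfib.coding_getElem hx (by simp), hfib.coding_getElem hy (by simp)]
        simp
      · obtain ⟨k, rfl⟩ := Nat.exists_eq_add_of_le' (show p.length + 2 ≤ n by omega)
        rw [Equiv.swap_apply_of_ne_of_ne (by omega) (by omega), coding_add, coding_add, hxy]

end Words

/-! ### Inverse branches of a full system -/

section Branch

variable {X : Type*} {T : X → X} {α : Set (Set X)}

/-- The inverse branch of `T^n` with values in the cylinder of the word `u` of length `n`. -/
noncomputable def branch [Nonempty X] (T : X → X) : List α → X → X
  | [], x => x
  | a :: u, x => Function.invFunOn T (a : Set X) (branch T u x)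

variable [Nonempty X]

lemma IsFull.invFunOn_mem (hfull : IsFull T α) (a : α) (x : X) :
    Function.invFunOn T (a : Set X) x ∈ (a : Set X) :=
  Function.invFunOn_mem ((hfull a a.2).superset (Set.mem_univ x))

lemma IsFull.apply_invFunOn (hfull : IsFull T α) (a : α) (x : X) :
    T (Function.invFunOn T (a : Set X) x) = x :=
  Function.invFunOn_eq ((hfull a a.2).superset (Set.mem_univ x))

lemma IsFull.branch_mem (hfull : IsFull T α) (u : List α) {B : Set X} {x : X} (hx : x ∈ B) :
    branch T u x ∈ prepend T u B := by
  induction u with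
  | nil => exact hx
  | cons a u ih =>
    exact ⟨hfull.invFunOn_mem a _, by
      rw [Set.mem_preimage, branch, hfull.apply_invFunOn]; exact ih⟩

lemma IsFull.iterate_branch (hfull : IsFull T α) (u : List α) (x : X) :
    T^[u.length] (branch T u x) = x :=
  (mem_prepend.1 (hfull.branch_mem u (Set.mem_singleton x))).2

variable [MeasurableSpace X] [StandardBorelSpace X]

lemma IsFibredSystem.branch_iterate (hfib : IsFibredSystem T α) (hfull : IsFull T α)
    {u : List α} {x : X} (hx : x ∈ prepend T u Set.univ) : branch T u (T^[u.length] x) = x := by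
  induction u generalizing x with
  | nil => rfl
  | cons a u ih =>
    rw [List.length_cons, Function.iterate_succ_apply, branch, ih hx.2]
    exact hfib.injOn a a.2 (hfull.invFunOn_mem a _) hx.1 (hfull.apply_invFunOn a _)

lemma IsFibredSystem.measurable_branch (hfib : IsFibredSystem T α) (hfull : IsFull T α)
    (u : List α) : Measurable (branch T u) := by
  induction u with
  | nil => exact measurable_id
  | cons a u ih =>
    refine Measurable.comp (g := Function.invFunOn T (a : Set X)) (fun B hB => ?_) ih
    have : Function.invFunOn T (a : Set X) ⁻¹' B = T '' ((a : Set X) ∩ B) := by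
      ext x
      constructor
      · intro hx
        exact ⟨_, ⟨hfull.invFunOn_mem a x, hx⟩, hfull.apply_invFunOn a x⟩
      · rintro ⟨y, ⟨hy, hyB⟩, rfl⟩
        have := hfib.injOn a a.2 (hfull.invFunOn_mem a _) hy (hfull.apply_invFunOn a _)
        rwa [Set.mem_preimage, this]
    rw [this]
    exact hfib.measurableSet_image a a.2 _ Set.inter_subset_left
      ((hfib.measurableSet a a.2).inter hB)

lemma IsFibredSystem.image_branch (hfib : IsFibredSystem T α) (hfull : IsFull T α)
    (u : List α) (B : Set X) : branch T u '' B = prepend T u B := by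
  ext x
  constructor
  · rintro ⟨y, hy, rfl⟩
    exact hfull.branch_mem u hy
  · intro hx
    rw [mem_prepend] at hx
    exact ⟨_, hx.2, hfib.branch_iterate hfull hx.1⟩

lemma IsFibredSystem.image_iterate_prepend (hfib : IsFibredSystem T α) (hfull : IsFull T α)
    (u : List α) (B : Set X) : T^[u.length] '' prepend T u B = B := by
  rw [← hfib.image_branch hfull, Set.image_image]
  simp [hfull.iterate_branch]

/-- Pulling back along the inverse branch gives `B`. Statements on a cylinder thus need checking
only on sets of the form `prepend T u B`. -/
lemma IsFibredSystem.eq_prepend_of_subset (hfib : IsFibredSystem T α) (hfull : IsFull T α)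
    (u : List α) {C : Set X} (hC : MeasurableSet C) (h : C ⊆ prepend T u Set.univ) :
    ∃ B, MeasurableSet B ∧ C = prepend T u B := by
  refine ⟨branch T u ⁻¹' C, hfib.measurable_branch hfull u hC, ?_⟩
  rw [← hfib.image_branch hfull, Set.image_preimage_eq_inter_range, ← Set.image_univ,
    hfib.image_branch hfull, Set.inter_eq_left.2 h]

end Branch

/-! ### From holonomy invariance to permutation of words -/

section Exchangeable

variable {X : Type*} {T : X → X} {α : Set (Set X)} [MeasurableSpace X]

/-- A measure is exchangeable if permuting the letters of an initial word does not change the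
measure of a set. -/
def IsExchangeable (T : X → X) (α : Set (Set X)) (μ : Measure X) : Prop :=
  ∀ u v : List α, u.Perm v → ∀ B, MeasurableSet B → μ (prepend T u B) = μ (prepend T v B)

variable [StandardBorelSpace X]

/-- Cutting off a word and pasting the word with two adjacent letters swapped is a holonomy;
adjacent swaps generate all permutations. -/
lemma IsFibredSystem.isExchangeable (hfib : IsFibredSystem T α) (hfull : IsFull T α)
    {μ : Measure X} (hinv : IsInvariant (exchangeableRel T α) μ) : IsExchangeable T α μ := by
  rcases isEmpty_or_nonempty X with hX | hX
  · intro u v _ B _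
    simp [Set.eq_empty_of_isEmpty]
  have key : ∀ (p : List α) (a b : α) (B : Set X), MeasurableSet B →
      μ (prepend T (p ++ [a, b]) B) = μ (prepend T (p ++ [b, a]) B) := by
    intro p a b B hB
    set u := p ++ [a, b] with hu
    set v := p ++ [b, a] with hv
    have hul : u.length = p.length + 2 := by simp [hu]
    have hvl : v.length = p.length + 2 := by simp [hv]
    have himage : ∀ C, (branch T v ∘ T^[p.length + 2]) '' prepend T u C = prepend T v C := by
      intro C
      rw [Set.image_comp, ← hul, hfib.image_iterate_prepend hfull, hfib.image_branch hfull]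
    have hmu := hfib.measurableSet_prepend u hB
    have hmv := hfib.measurableSet_prepend v hB
    have hmeas : Measurable (branch T v ∘ T^[p.length + 2]) :=
      (hfib.measurable_branch hfull v).comp (hfib.measurable_map.iterate _)
    have hol : IsHolonomy (exchangeableRel T α) (prepend T u B) (prepend T v B)
        (branch T v ∘ T^[p.length + 2]) := by
      refine ⟨hmu, hmv, ?_, fun C _ hC => hmu.inter (hmeas hC), fun C hC hCm => ?_, fun x hx => ?_⟩
      · refine Set.BijOn.mk (Set.mapsTo_iff_image_subset.2 (himage B).subset) ?_
          (himage B).superset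
        intro x hx y hy hxy
        have := congrArg (T^[v.length]) hxy
        simp only [Function.comp_apply, hfull.iterate_branch] at this
        rw [← hul] at this
        rw [← hfib.branch_iterate hfull (mem_prepend.1 hx).1, this,
          hfib.branch_iterate hfull (mem_prepend.1 hy).1]
      · obtain ⟨D, hD, rfl⟩ := hfib.eq_prepend_of_subset hfull u hCm
          (hC.trans (prepend_mono _ (Set.subset_univ _)))
        rw [himage]
        exact hfib.measurableSet_prepend v hD
      · refine hfib.exchangeableRel_swap (mem_prepend.1 hx).1
          (hfull.branch_mem v (Set.mem_univ _)) ?_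
        have := hfull.iterate_branch v (T^[p.length + 2] x)
        rw [hvl] at this
        exact this.symm
    have := hinv _ _ _ hol _ subset_rfl hmu
    rw [himage] at this
    exact this.symm
  -- The prefix `p` is arbitrary so that the `cons` case can absorb the common first letter into it.
  have main : ∀ u v : List α, u.Perm v → ∀ (p : List α) (B : Set X), MeasurableSet B →
      μ (prepend T (p ++ u) B) = μ (prepend T (p ++ v) B) := by
    intro u v h
    induction h with
    | nil => exact fun _ _ _ => rfl
    | cons a _ ih =>
      intro p B hB
      simpa using ih (p ++ [a]) B hB
    | swap a b l =>
      intro p B hB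
      have := key p b a _ (hfib.measurableSet_prepend l hB)
      rwa [← prepend_append, ← prepend_append, List.append_assoc, List.append_assoc] at this
    | trans _ _ h1 h2 => exact fun p B hB => (h1 p B hB).trans (h2 p B hB)
  exact fun u v h B hB => main u v h [] B hB

end Exchangeable

/-! ### Finite exchangeable measures: invariant densities -/

section AfterWord

variable {X : Type*} {T : X → X} {α : Set (Set X)} [MeasurableSpace X]

/-- The law under `μ` of what follows the initial word `u`. -/
noncomputable def afterWord (T : X → X) (μ : Measure X) (u : List α) : Measure X :=
  (μ.restrict (prepend T u Set.univ)).map T^[u.length]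

instance (μ : Measure X) [IsFiniteMeasure μ] (u : List α) : IsFiniteMeasure (afterWord T μ u) := by
  unfold afterWord; infer_instance

/-- The density of the law of `T x` on the event `x ∈ a`, i.e. the conditional probability of `a`
given the exchangeable events. -/
noncomputable def letterDensity (T : X → X) (P : Measure X) (a : α) : X → ℝ≥0∞ :=
  (afterWord T P [a]).rnDeriv P

lemma measurable_letterDensity (P : Measure X) (a : α) : Measurable (letterDensity T P a) :=
  Measure.measurable_rnDeriv _ _

variable [StandardBorelSpace X]

lemma IsFibredSystem.afterWord_apply (hfib : IsFibredSystem T α) (μ : Measure X) (u : List α)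
    {B : Set X} (hB : MeasurableSet B) : afterWord T μ u B = μ (prepend T u B) := by
  have := (hfib.measurable_map.iterate u.length)
  rw [afterWord, Measure.map_apply this hB, Measure.restrict_apply (this hB), Set.inter_comm,
    ← prepend_eq_inter]

lemma IsFibredSystem.afterWord_append (hfib : IsFibredSystem T α) (μ : Measure X) (u v : List α) :
    afterWord T μ (u ++ v) = afterWord T (afterWord T μ u) v := by
  ext B hB
  rw [hfib.afterWord_apply _ _ hB, hfib.afterWord_apply _ _ hB,
    hfib.afterWord_apply _ _ (hfib.measurableSet_prepend v hB), prepend_append]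

lemma IsExchangeable.isExchangeable_afterWord {μ : Measure X} (hμ : IsExchangeable T α μ)
    (hfib : IsFibredSystem T α) (u : List α) : IsExchangeable T α (afterWord T μ u) := by
  intro v w h B hB
  rw [hfib.afterWord_apply _ _ (hfib.measurableSet_prepend v hB),
    hfib.afterWord_apply _ _ (hfib.measurableSet_prepend w hB), ← prepend_append,
    ← prepend_append]
  exact hμ _ _ (h.append_left u) B hB

/-- A finite exchangeable measure is shift invariant. -/
lemma IsExchangeable.measurePreserving {μ : Measure X} [IsFiniteMeasure μ]
    (hμ : IsExchangeable T α μ) (hfib : IsFibredSystem T α) : MeasurePreserving T μ μ := by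
  refine ⟨hfib.measurable_map, hfib.ext_of_prepend fun u => ?_⟩
  have hu := hfib.measurableSet_prepend u MeasurableSet.univ
  rw [Measure.map_apply hfib.measurable_map hu,
    hfib.measure_eq_tsum μ (hfib.measurable_map hu)]
  -- Moving the first letter to the end turns the sum over letters before `u` into the sum over
  -- letters after `u`.
  have h1 : ∀ a : α, μ ((a : Set X) ∩ T ⁻¹' prepend T u Set.univ)
      = afterWord T μ u a := by
    intro a
    rw [hfib.afterWord_apply _ _ (hfib.measurableSet a a.2), ← prepend_cons,
      hμ (a :: u) (u ++ [a]) (List.perm_append_singleton a u).symm _ MeasurableSet.univ,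
      prepend_append]
    simp [prepend_cons]
  simp_rw [h1]
  rw [← hfib.afterWord_apply μ u MeasurableSet.univ,
    hfib.measure_eq_tsum (afterWord T μ u) MeasurableSet.univ]
  simp

lemma IsFibredSystem.afterWord_singleton_le (hfib : IsFibredSystem T α) {μ : Measure X}
    (hμ : MeasurePreserving T μ μ) (a : α) : afterWord T μ [a] ≤ μ := by
  refine Measure.le_iff.2 fun B hB => ?_
  rw [hfib.afterWord_apply _ _ hB, ← hμ.measure_preimage hB.nullMeasurableSet]
  exact measure_mono Set.inter_subset_right

/-- Numerator and denominator of the derivative are both finite exchangeable, hence `T`-invariant,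
measures. -/
lemma IsExchangeable.letterDensity_comp {P : Measure X} [IsFiniteMeasure P]
    (hP : IsExchangeable T α P) (hfib : IsFibredSystem T α) (a : α) :
    letterDensity T P a ∘ T =ᵐ[P] letterDensity T P a :=
  ((hP.isExchangeable_afterWord hfib [a]).measurePreserving hfib).rnDeriv_comp_aeEq
    (hP.measurePreserving hfib)

lemma IsExchangeable.letterDensity_iterate {P : Measure X} [IsFiniteMeasure P]
    (hP : IsExchangeable T α P) (hfib : IsFibredSystem T α) :
    ∀ᵐ x ∂P, ∀ n, ∀ a : α, letterDensity T P a (T^[n] x) = letterDensity T P a x := by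
  have := hfib.countable.to_subtype
  rw [ae_all_iff]
  intro n
  rw [ae_all_iff]
  intro a
  induction n with
  | zero => exact ae_of_all _ fun _ => rfl
  | succ n ih =>
    filter_upwards [ih, ((hP.measurePreserving hfib).iterate n).quasiMeasurePreserving.ae
      (hP.letterDensity_comp hfib a)] with x h1 h2
    rw [Function.iterate_succ_apply', ← h1]
    exact h2

/-- The density `g` of `R` with respect to `P` is shift invariant, so it can be evaluated after the
letter `a` is removed and factors out. The conditional letter probabilities of `P` thus serve every
exchangeable `R ≪ P`. -/
lemma IsExchangeable.afterWord_singleton_eq {P R : Measure X} [IsFiniteMeasure P]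
    [IsFiniteMeasure R] (hP : IsExchangeable T α P) (hR : IsExchangeable T α R) (hRP : R ≪ P)
    (hfib : IsFibredSystem T α) (a : α) :
    afterWord T R [a] = R.withDensity (letterDensity T P a) := by
  have hg := (hR.measurePreserving hfib).rnDeriv_comp_aeEq (hP.measurePreserving hfib)
  set g := R.rnDeriv P with hgdef
  have hgm : Measurable g := Measure.measurable_rnDeriv _ _
  have hRg : P.withDensity g = R := Measure.withDensity_rnDeriv_eq _ _ hRP
  have hPa : P.withDensity (letterDensity T P a) = afterWord T P [a] :=
    Measure.withDensity_rnDeriv_eq _ _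
      (hfib.afterWord_singleton_le (hP.measurePreserving hfib) a).absolutelyContinuous
  ext B hB
  have hBm := hfib.measurableSet_prepend [a] hB
  calc afterWord T R [a] B = ∫⁻ x in prepend T [a] B, g x ∂P := by
        rw [hfib.afterWord_apply _ _ hB, ← withDensity_apply _ hBm, hRg]
    _ = ∫⁻ x in prepend T [a] B, g (T x) ∂P :=
        lintegral_congr_ae (ae_restrict_of_ae (hg.mono fun x hx => hx.symm))
    _ = ∫⁻ x in B, g x ∂(afterWord T P [a]) := by
        rw [afterWord, setLIntegral_map hB hgm (hfib.measurable_map.iterate _),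
          Measure.restrict_restrict (hfib.measurable_map.iterate _ hB), Set.inter_comm,
          ← prepend_eq_inter]
        rfl
    _ = ∫⁻ x in B, letterDensity T P a x ∂(R) := by
        rw [← hPa, ← hRg, setLIntegral_withDensity_eq_setLIntegral_mul _
          (measurable_letterDensity P a) hgm hB, setLIntegral_withDensity_eq_setLIntegral_mul _
          hgm (measurable_letterDensity P a) hB, mul_comm]
    _ = _ := (withDensity_apply _ hB).symm

lemma IsExchangeable.afterWord_absolutelyContinuous {R : Measure X} [IsFiniteMeasure R]
    (hR : IsExchangeable T α R) (hfib : IsFibredSystem T α) (u : List α) :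
    afterWord T R u ≪ R := by
  refine Measure.AbsolutelyContinuous.mk fun B hB h0 => ?_
  rw [hfib.afterWord_apply _ _ hB]
  rw [← ((hR.measurePreserving hfib).iterate u.length).measure_preimage hB.nullMeasurableSet] at h0
  rw [prepend_eq_inter]
  exact measure_mono_null Set.inter_subset_right h0

/-- The law after one letter is again exchangeable and absolutely continuous with respect to `P`, so
each further letter contributes a factor from the same family of densities. This is conditional
independence. -/
lemma IsExchangeable.afterWord_eq_withDensity {P R : Measure X} [IsFiniteMeasure P]
    [IsFiniteMeasure R] (hP : IsExchangeable T α P) (hR : IsExchangeable T α R) (hRP : R ≪ P)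
    (hfib : IsFibredSystem T α) (u : List α) :
    afterWord T R u
      = R.withDensity fun x => (u.map fun a => letterDensity T P a x).prod := by
  have hm : ∀ v : List α, Measurable fun x => (v.map fun a => letterDensity T P a x).prod := by
    intro v
    induction v with
    | nil => simp
    | cons a v ih =>
      simp only [List.map_cons, List.prod_cons]
      exact (measurable_letterDensity P a).mul ih
  induction u generalizing R with
  | nil =>
    ext B hB
    rw [hfib.afterWord_apply _ _ hB]
    simp
  | cons a u ih =>
    rw [← List.singleton_append, hfib.afterWord_append, ih (hR.isExchangeable_afterWord hfib [a])
      ((hR.afterWord_absolutelyContinuous hfib [a]).trans hRP),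
      hP.afterWord_singleton_eq hR hRP hfib, ← withDensity_mul _ (measurable_letterDensity P a)
      (hm u)]
    simp [Pi.mul_def]

end AfterWord

/-! ### Local finiteness implies recurrence -/

section Recurrence

variable {X : Type*} {T : X → X} {α : Set (Set X)}

lemma visits_eq_zero_iff {A : Set X} {x : X} : visits T A x = 0 ↔ ∀ i, T^[i] x ∉ A := by
  simp [visits, ENNReal.tsum_eq_zero]

lemma exists_visit_of_visits_eq_top {A : Set X} {x : X} (h : visits T A x = ∞) (n : ℕ) :
    ∃ i, n ≤ i ∧ T^[i] x ∈ A := by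
  by_contra! hc
  refine ENNReal.natCast_ne_top n (top_le_iff.1 ?_)
  calc ∞ = visits T A x := h.symm
    _ = ∑ i ∈ Finset.range n, A.indicator (fun _ => (1 : ℝ≥0∞)) (T^[i] x) :=
        tsum_eq_sum fun i hi => Set.indicator_of_notMem (hc i (by simpa using hi)) _
    _ ≤ ∑ i ∈ Finset.range n, 1 :=
        Finset.sum_le_sum fun i _ => Set.indicator_le_self' (by simp) _
    _ = n := by simp

lemma visits_eq_top_of_forall_exists {A : Set X} {x : X}
    (h : ∀ n, ∃ i, n ≤ i ∧ T^[i] x ∈ A) : visits T A x = ∞ := by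
  have hinf : {i | T^[i] x ∈ A}.Infinite := Set.infinite_of_not_bddAbove fun ⟨N, hN⟩ => by
    obtain ⟨i, hi, hA⟩ := h (N + 1)
    exact absurd (hN hA) (by omega)
  have : visits T A x = ∑' i, ({i | T^[i] x ∈ A}).indicator (fun _ => (1 : ℝ≥0∞)) i := by
    rw [visits]
    congr 1
  rw [this, ← tsum_subtype {i | T^[i] x ∈ A} fun _ => (1 : ℝ≥0∞), ENNReal.tsum_set_one,
    hinf.encard_eq]
  rfl

variable [MeasurableSpace X] [StandardBorelSpace X]

lemma IsFibredSystem.measurableSet_no_visit (hfib : IsFibredSystem T α) (a : α) :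
    MeasurableSet {x | ∀ i, T^[i] x ∉ (a : Set X)} := by
  simp only [Set.ofPred_forall]
  exact MeasurableSet.iInter fun i =>
    (hfib.measurable_map.iterate i (hfib.measurableSet a a.2)).compl

lemma IsFibredSystem.measurableSet_single_visit (hfib : IsFibredSystem T α) (a : α) (j : ℕ) :
    MeasurableSet {x | ∀ i, T^[i] x ∈ (a : Set X) ↔ i = j} := by
  have hm : ∀ i, MeasurableSet (T^[i] ⁻¹' (a : Set X)) := fun i =>
    hfib.measurable_map.iterate i (hfib.measurableSet a a.2)
  simp only [Set.ofPred_forall]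
  refine MeasurableSet.iInter fun i => ?_
  by_cases h : i = j
  · simp only [h, iff_true]
    exact hm j
  · simp only [h, iff_false]
    exact (hm i).compl

/-- Points visiting `a` exactly once, at time `j`, are as likely as points visiting `a` only right
after the initial word. -/
lemma IsExchangeable.measure_prepend_single_visit {μ : Measure X} (hμ : IsExchangeable T α μ)
    (hfib : IsFibredSystem T α) (a : α) (j : ℕ) (v : List α) :
    μ (prepend T v {x | ∀ i, T^[i] x ∈ (a : Set X) ↔ i = j})
      = μ (prepend T (v ++ [a]) {x | ∀ i, T^[i] x ∉ (a : Set X)}) := by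
  have hZ := hfib.measurableSet_no_visit a
  have hS := hfib.measurableSet_single_visit a
  induction j generalizing v with
  | zero =>
    rw [prepend_append]
    congr 2
    ext x
    constructor
    · intro h
      exact ⟨(h 0).2 rfl, fun i hi => by simpa using (h (i + 1)).1 hi⟩
    · rintro ⟨h1, h2⟩ i
      cases i with
      | zero => simpa using h1
      | succ i => simpa using h2 i
  | succ j ih =>
    rw [← hfib.afterWord_apply _ _ (hS _), hfib.measure_eq_tsum _ (hS _),
      ← hfib.afterWord_apply _ _ hZ, hfib.measure_eq_tsum _ hZ]
    -- Split by the letter `b` after `v`. For `b = a` both terms vanish; otherwise apply the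
    -- induction hypothesis to `v ++ [b]` and swap `b` with `a`.
    refine tsum_congr fun b => ?_
    by_cases hb : b = a
    · subst hb
      have h1 : (b : Set X) ∩ {x | ∀ i, T^[i] x ∈ (b : Set X) ↔ i = j + 1} = ∅ :=
        Set.eq_empty_of_forall_notMem fun x hx => by simpa using (hx.2 0).1 hx.1
      have h2 : (b : Set X) ∩ {x | ∀ i, T^[i] x ∉ (b : Set X)} = ∅ :=
        Set.eq_empty_of_forall_notMem fun x hx => hx.2 0 hx.1
      rw [h1, h2, measure_empty, measure_empty]
    · have hne : ∀ x, x ∈ (b : Set X) → x ∉ (a : Set X) := fun x h1 h2 =>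
        hb (hfib.letter_unique h1 h2)
      have h1 : (b : Set X) ∩ {x | ∀ i, T^[i] x ∈ (a : Set X) ↔ i = j + 1}
          = prepend T [b] {x | ∀ i, T^[i] x ∈ (a : Set X) ↔ i = j} := by
        ext x
        constructor
        · exact fun h => ⟨h.1, fun i => by simpa using h.2 (i + 1)⟩
        · refine fun h => ⟨h.1, fun i => ?_⟩
          cases i with
          | zero => simpa using hne x h.1
          | succ i => simpa using h.2 i
      have h2 : (b : Set X) ∩ {x | ∀ i, T^[i] x ∉ (a : Set X)}
          = prepend T [b] {x | ∀ i, T^[i] x ∉ (a : Set X)} := by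
        ext x
        constructor
        · exact fun h => ⟨h.1, fun i => h.2 (i + 1)⟩
        · refine fun h => ⟨h.1, fun i => ?_⟩
          cases i with
          | zero => exact hne x h.1
          | succ i => exact h.2 i
      rw [h1, h2, hfib.afterWord_apply _ _ (hfib.measurableSet_prepend _ (hS _)),
        hfib.afterWord_apply _ _ (hfib.measurableSet_prepend _ hZ), ← prepend_append,
        ← prepend_append, ih]
      refine hμ _ _ ?_ _ hZ
      simpa using (List.Perm.swap a b []).append_left v

/-- The events that `a` is visited exactly once after `v`, at time `j`, are disjoint for distinct
`j`, all have this measure, and lie in a cylinder of finite measure. -/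
lemma IsExchangeable.measure_prepend_cons_eq_zero {μ : Measure X} (hμ : IsExchangeable T α μ)
    (hfib : IsFibredSystem T α) (a : α) {v : List α} (hv : μ (prepend T v Set.univ) < ∞) :
    μ (prepend T (a :: v) {x | ∀ i, T^[i] x ∉ (a : Set X)}) = 0 := by
  have hZ := hfib.measurableSet_no_visit a
  have hS := hfib.measurableSet_single_visit a
  rw [hμ _ _ (List.perm_append_singleton a v).symm _ hZ]
  by_contra h0
  refine hv.ne (top_le_iff.1 ?_)
  calc ∞ = ∑' j : ℕ, μ (prepend T v {x | ∀ i, T^[i] x ∈ (a : Set X) ↔ i = j}) := by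
        simp_rw [hμ.measure_prepend_single_visit hfib]
        rw [ENNReal.tsum_const_eq_top_of_ne_zero h0]
    _ = μ (⋃ j : ℕ, prepend T v {x | ∀ i, T^[i] x ∈ (a : Set X) ↔ i = j}) :=
        (measure_iUnion (fun j k hjk => prepend_disjoint v <| Set.disjoint_left.2
          fun x hj hk => hjk ((hk j).1 ((hj j).2 rfl)))
          fun j => hfib.measurableSet_prepend v (hS j)).symm
    _ ≤ μ (prepend T v Set.univ) := measure_mono <| Set.iUnion_subset fun j =>
        prepend_mono v (Set.subset_univ _)

/-- The set of points lying in some cylinder of finite measure. -/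
def finitePart (T : X → X) (α : Set (Set X)) (μ : Measure X) : Set X :=
  {x | ∃ u : List α, x ∈ prepend T u Set.univ ∧ μ (prepend T u Set.univ) < ∞}

lemma IsFibredSystem.measurableSet_finitePart (hfib : IsFibredSystem T α) (μ : Measure X) :
    MeasurableSet (finitePart T α μ) := by
  have := hfib.countable.to_subtype
  simp only [finitePart, Set.ofPred_exists, Set.ofPred_and]
  exact MeasurableSet.iUnion fun u =>
    (hfib.measurableSet_prepend u MeasurableSet.univ).inter (MeasurableSet.const _)

/-- A small cylinder around a point of `Y` lies in an open set of finite measure on `Y`; its part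
outside `Y` is null. -/
lemma IsFibredSystem.subset_finitePart (hfib : IsFibredSystem T α) {μ : Measure X} {Y : Set X}
    (hY0 : μ Yᶜ = 0) (h : IsLocallyFiniteOn (cylinderTopology T α) μ Y) :
    Y ⊆ finitePart T α μ := by
  obtain ⟨𝒰, -, h𝒰, hcov⟩ := h
  intro x hx
  obtain ⟨U, hU, hxU⟩ := hcov hx
  obtain ⟨N, hN⟩ := hfib.exists_prepend_subset (h𝒰 U hU).1 hxU
  obtain ⟨u, hu, hxu⟩ := hfib.exists_word N x
  refine ⟨u, hxu, ?_⟩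
  calc μ (prepend T u Set.univ) ≤ μ (Y ∩ U ∪ Yᶜ) := measure_mono fun y hy => by
        by_cases h : y ∈ Y
        · exact Or.inl ⟨h, hN u hu.ge hxu hy⟩
        · exact Or.inr h
    _ ≤ μ (Y ∩ U) + μ Yᶜ := measure_union_le _ _
    _ < ∞ := by rw [hY0, add_zero]; exact (h𝒰 U hU).2

lemma IsFibredSystem.exists_long_word (hfib : IsFibredSystem T α) {μ : Measure X} {x : X}
    (hx : x ∈ finitePart T α μ) : ∃ N : ℕ, ∀ u : List α, N ≤ u.length →
      x ∈ prepend T u Set.univ → μ (prepend T u Set.univ) < ∞ := by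
  obtain ⟨v, hv, hfin⟩ := hx
  refine ⟨v.length, fun u hu hxu => ?_⟩
  obtain ⟨w, rfl⟩ := hfib.prefix_of_mem hv hxu hu
  refine (measure_mono ?_).trans_lt hfin
  rw [prepend_append]
  exact prepend_mono _ (Set.subset_univ _)

/-- An exchangeable measure for which all points have cylinders of finite measure around them is
recurrent. -/
lemma IsExchangeable.isRecurrent {μ : Measure X} (hμ : IsExchangeable T α μ)
    (hfib : IsFibredSystem T α) (hfin : finitePart T α μ = Set.univ) : IsRecurrent T α μ := by
  have := hfib.countable.to_subtype
  intro A hA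
  set a : α := ⟨A, hA⟩
  set Z : Set X := {x | ∀ i, T^[i] x ∉ A} with hZ
  have hZT : ∀ x ∈ Z, ∀ n, T^[n] x ∈ Z := fun x hx n i => by
    rw [← Function.iterate_add_apply]
    exact hx _
  have hnull : ∀ u : List α, a ∈ u → μ (prepend T u Z) = 0 := by
    intro u hu
    obtain ⟨s, hs⟩ : ∃ s, u.Perm (a :: s) := ⟨_, List.perm_cons_erase hu⟩
    have hZm : MeasurableSet Z := hfib.measurableSet_no_visit a
    rw [hμ _ _ hs _ hZm]
    -- The cylinder of `s` may have infinite measure, but `T x` lies in a finite cylinder of some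
    -- word `v` at least as long, and the tail after `v` still avoids `a`. Finiteness is used at `T
    -- x`, not at `x`.
    have hsub : prepend T (a :: s) Z ⊆
        ⋃ v : {v : List α // μ (prepend T v Set.univ) < ∞}, prepend T (a :: v.1) Z := by
      rintro x ⟨hxa, hx⟩
      obtain ⟨N, hN⟩ := hfib.exists_long_word (hfin ▸ Set.mem_univ (T x))
      obtain ⟨v, hv, hxv⟩ := hfib.exists_word (max N s.length) (T x)
      refine Set.mem_iUnion.2 ⟨⟨v, hN v (by omega) hxv⟩, hxa, mem_prepend.2 ⟨hxv, ?_⟩⟩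
      obtain ⟨k, hk⟩ := Nat.exists_eq_add_of_le' (show s.length ≤ v.length by omega)
      rw [hk, Function.iterate_add_apply]
      exact hZT _ (mem_prepend.1 hx).2 _
    refine measure_mono_null hsub (measure_iUnion_null fun v => ?_)
    exact hμ.measure_prepend_cons_eq_zero hfib a v.2
  have hall : ∀ᵐ x ∂μ, ∀ u : List α, a ∈ u → x ∉ prepend T u Z := by
    rw [ae_all_iff]
    intro u
    by_cases hu : a ∈ u
    · filter_upwards [measure_eq_zero_iff_ae_notMem.1 (hnull u hu)] with x hx _ using hx
    · exact ae_of_all _ fun x h => (hu h).elim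
  filter_upwards [hall] with x hx
  by_cases h : ∀ n, ∃ i, n ≤ i ∧ T^[i] x ∈ A
  · exact Or.inr (visits_eq_top_of_forall_exists h)
  · left
    rw [visits_eq_zero_iff]
    push Not at h
    obtain ⟨n, hn⟩ := h
    -- No visit occurs from time `n` on, so by `hx` the initial word `u` of length `n` cannot
    -- contain `a` either.
    obtain ⟨u, hu, hxu⟩ := hfib.exists_word n x
    have hxZ : x ∈ prepend T u Z := mem_prepend.2 ⟨hxu, fun i => by
      rw [← Function.iterate_add_apply]
      exact hn _ (by omega)⟩
    have hau : a ∉ u := fun h => hx u h hxZ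
    intro i hi
    rcases lt_or_ge i n with hin | hin
    · refine hau (List.mem_iff_getElem.2 ⟨i, by omega, ?_⟩)
      have h1 := hfib.coding_getElem hxu (n := i) (by omega)
      have h2 := hfib.coding_eq (a := a) hi
      exact Subtype.ext (h1.symm.trans h2)
    · exact hn i hin hi

end Recurrence

/-! ### Reduction to a finite measure and disintegration -/

section Mixture

variable {X : Type*} {T : X → X} {α : Set (Set X)}

lemma visits_iterate_eq_top {A : Set X} {x : X} (h : visits T A x = ∞) (n : ℕ) :
    visits T A (T^[n] x) = ∞ := by
  refine visits_eq_top_of_forall_exists fun m => ?_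
  obtain ⟨i, hi, hA⟩ := exists_visit_of_visits_eq_top h (m + n)
  refine ⟨i - n, by omega, ?_⟩
  rwa [← Function.iterate_add_apply, Nat.sub_add_cancel (by omega)]

/-- The weighted sum of the products `∏ a ∈ u, θ a` over all words. -/
noncomputable def weightedProd (c : List α → ℝ≥0∞) (θ : α → ℝ≥0∞) : ℝ≥0∞ :=
  ∑' u, c u * (u.map θ).prod

lemma measurable_list_prod_map (u : List α) : Measurable fun θ : α → ℝ≥0∞ => (u.map θ).prod := by
  induction u with
  | nil => simp
  | cons a u ih =>
    simp only [List.map_cons, List.prod_cons]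
    exact (measurable_pi_apply a).mul ih

lemma measurable_weightedProd [Countable α] (c : List α → ℝ≥0∞) :
    Measurable (weightedProd c) :=
  Measurable.tsum fun u => (measurable_list_prod_map u).const_mul _

variable [MeasurableSpace X]

/-- The vector of all conditional letter probabilities. -/
noncomputable def densityVector (T : X → X) (α : Set (Set X)) (P : Measure X) (x : X) :
    α → ℝ≥0∞ := fun a => letterDensity T P a x

lemma measurable_densityVector (P : Measure X) : Measurable (densityVector T α P) :=
  measurable_pi_iff.2 fun a => measurable_letterDensity P a

/-- Weights making `∑ u, weight u • afterWord μ u` a finite measure. -/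
lemma exists_weight [Countable α] (T : X → X) (μ : Measure X) :
    ∃ c : List α → ℝ≥0∞, (∀ u, c u ≠ 0 ↔ μ (prepend T u Set.univ) < ∞) ∧ ∑' u, c u ≠ ∞ ∧
      ∑' u, c u * μ (prepend T u Set.univ) ≠ ∞ := by
  obtain ⟨δ, hδ, hsum⟩ := ENNReal.exists_pos_sum_of_countable' one_ne_zero (List α)
  -- This weight vanishes exactly on words of infinite measure, and both it and its product with the
  -- measure of the cylinder are at most `δ u`.
  refine ⟨fun u => δ u * (1 + μ (prepend T u Set.univ))⁻¹, fun u => ?_,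
    (lt_of_le_of_lt (ENNReal.tsum_le_tsum fun u => ?_) (hsum.trans_le le_top)).ne,
    (lt_of_le_of_lt (ENNReal.tsum_le_tsum fun u => ?_) (hsum.trans_le le_top)).ne⟩
  · simp [(hδ u).ne', lt_top_iff_ne_top]
  · exact mul_le_of_le_one_right' (ENNReal.inv_le_one.2 le_self_add)
  · rw [mul_assoc]
    refine mul_le_of_le_one_right' ?_
    rw [mul_comm, ← div_eq_mul_inv]
    exact ENNReal.div_le_of_le_mul (by rw [one_mul]; exact le_add_self)

/-- The weighted sum of the laws of what follows an initial word. -/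
noncomputable def weightedLaw (T : X → X) (μ : Measure X) (c : List α → ℝ≥0∞) : Measure X :=
  Measure.sum fun u => c u • afterWord T μ u

lemma afterWord_absolutelyContinuous_weightedLaw (μ : Measure X) {c : List α → ℝ≥0∞}
    {u : List α} (hu : c u ≠ 0) : afterWord T μ u ≪ weightedLaw T μ c :=
  (Measure.AbsolutelyContinuous.rfl.smul_right hu).trans
    (Measure.absolutelyContinuous_sum_right u Measure.AbsolutelyContinuous.rfl)

/-- A probability measure that is multiplicative on the cylinders of words is a product measure. -/
lemma isProductMeasure_of_prepend {m : Measure X}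
    [IsProbabilityMeasure m]
    (h : ∀ u : List α, m (prepend T u Set.univ) = (u.map fun a : α => m (a : Set X)).prod) :
    IsProductMeasure T α m := by
  refine ⟨inferInstance, fun n a ha => ?_⟩
  have h1 := cyl_eq_prepend (T := T) fun j => (⟨a j, ha j⟩ : α)
  simp only at h1
  rw [h1, h, List.map_ofFn, List.prod_ofFn]
  rfl

variable [StandardBorelSpace X]

/-- A recurrent exchangeable measure gives almost no mass to points that leave the finite part. -/
lemma IsExchangeable.ae_iterate_mem_finitePart {μ : Measure X} (hμ : IsExchangeable T α μ)
    (hfib : IsFibredSystem T α) (hrec : IsRecurrent T α μ)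
    (hfin : ∀ᵐ x ∂μ, x ∈ finitePart T α μ) : ∀ᵐ x ∂μ, ∀ n, T^[n] x ∈ finitePart T α μ := by
  have := hfib.countable.to_subtype
  have hrec' : ∀ᵐ x ∂μ, ∀ a : α, visits T (a : Set X) x = 0 ∨ visits T (a : Set X) x = ∞ :=
    ae_all_iff.2 fun a => hrec a a.2
  filter_upwards [hrec', hfin] with x hx hxf n
  have hx' : ∀ n, ∀ a : α, T^[n] x ∈ (a : Set X) → visits T (a : Set X) (T^[n] x) = ∞ := by
    intro n a ha
    refine visits_iterate_eq_top ((hx a).resolve_left fun h => ?_) n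
    exact visits_eq_zero_iff.1 h n ha
  induction n with
  | zero => exact hxf
  | succ n ih =>
    rw [Function.iterate_succ_apply']
    replace hx' := hx' n
    generalize T^[n] x = y at ih hx'
    obtain ⟨a, ha⟩ := hfib.exists_letter y
    obtain ⟨N, hN⟩ := hfib.exists_long_word ih
    obtain ⟨i, hi, hia⟩ := exists_visit_of_visits_eq_top (hx' a ha) (N + 1)
    obtain ⟨i, rfl⟩ := Nat.exists_eq_add_of_le' (show 1 ≤ i by omega)
    obtain ⟨u, hu, hyu⟩ := hfib.exists_word i (T y)
    have h1 : y ∈ prepend T (a :: u) Set.univ := ⟨ha, hyu⟩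
    -- The letter `a` at `y` recurs right after `u`, so the word `u ++ [a]` read from `T y` permutes
    -- the word `a :: u` read from `y`, which is long enough to have finite measure.
    refine ⟨u ++ [a], ?_, ?_⟩
    · rw [prepend_append, mem_prepend]
      refine ⟨hyu, ?_, trivial⟩
      rw [hu]
      exact hia
    · rw [hμ _ _ (List.perm_append_singleton a u) _ MeasurableSet.univ]
      exact hN _ (by simp; omega) h1

lemma IsFibredSystem.weightedLaw_apply (hfib : IsFibredSystem T α) (μ : Measure X)
    (c : List α → ℝ≥0∞) {B : Set X} (hB : MeasurableSet B) :
    weightedLaw T μ c B = ∑' u, c u * μ (prepend T u B) := by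
  simp [weightedLaw, Measure.sum_apply _ hB, hfib.afterWord_apply _ _ hB]

lemma IsFibredSystem.isFiniteMeasure_weightedLaw (hfib : IsFibredSystem T α) {μ : Measure X}
    {c : List α → ℝ≥0∞} (hc : ∑' u, c u * μ (prepend T u Set.univ) ≠ ∞) :
    IsFiniteMeasure (weightedLaw T μ c) :=
  ⟨by rw [hfib.weightedLaw_apply _ _ MeasurableSet.univ]; exact hc.lt_top⟩

lemma IsExchangeable.isExchangeable_weightedLaw {μ : Measure X} (hμ : IsExchangeable T α μ)
    (hfib : IsFibredSystem T α) (c : List α → ℝ≥0∞) :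
    IsExchangeable T α (weightedLaw T μ c) := by
  intro v w h B hB
  rw [hfib.weightedLaw_apply _ _ (hfib.measurableSet_prepend v hB),
    hfib.weightedLaw_apply _ _ (hfib.measurableSet_prepend w hB)]
  simp_rw [← prepend_append]
  exact tsum_congr fun u => by rw [hμ _ _ (h.append_left u) B hB]

/-- A recurrent exchangeable measure `μ` whose finite part has full measure is equivalent to a
finite exchangeable measure `P`, with a density that depends on the conditional letter
probabilities of `P` only. -/
theorem IsExchangeable.exists_eq_withDensity {μ : Measure X} (hμ : IsExchangeable T α μ)
    (hfib : IsFibredSystem T α) (hfull : IsFull T α) (hrec : IsRecurrent T α μ)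
    (hfin : ∀ᵐ x ∂μ, x ∈ finitePart T α μ) :
    ∃ (P : Measure X) (h : (α → ℝ≥0∞) → ℝ≥0∞), IsFiniteMeasure P ∧ IsExchangeable T α P ∧
      Measurable h ∧ (∀ᵐ x ∂P, h (densityVector T α P x) ≠ ∞) ∧
      μ = P.withDensity fun x => h (densityVector T α P x) := by
  have := hfib.countable.to_subtype
  rcases isEmpty_or_nonempty X with hX | hX
  · exact ⟨0, 0, inferInstance, fun _ _ _ _ _ => rfl, measurable_zero, by simp,
      Subsingleton.elim _ _⟩
  obtain ⟨c, hc0, hcs, hcm⟩ := exists_weight (α := α) T μ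
  set P := weightedLaw T μ c with hP
  have hPfin : IsFiniteMeasure P := hfib.isFiniteMeasure_weightedLaw hcm
  have hPex : IsExchangeable T α P := hμ.isExchangeable_weightedLaw hfib c
  have hPae : ∀ {B : Set X}, MeasurableSet B → (∀ u, c u ≠ 0 → afterWord T μ u B = 0) →
      P B = 0 := by
    intro B hB h
    rw [hP, hfib.weightedLaw_apply _ _ hB, ENNReal.tsum_eq_zero]
    intro u
    by_cases hu : c u = 0
    · simp [hu]
    · rw [← hfib.afterWord_apply _ _ hB, h u hu, mul_zero]
  have hufin : ∀ u, c u ≠ 0 → IsFiniteMeasure (afterWord T μ u) := fun u hu =>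
    ⟨by rw [hfib.afterWord_apply _ _ MeasurableSet.univ]; exact (hc0 u).1 hu⟩
  have hab : ∀ u, c u ≠ 0 → afterWord T μ u ≪ P := fun u hu =>
    afterWord_absolutelyContinuous_weightedLaw μ hu
  set F := densityVector T α P with hF
  have hFm : Measurable F := measurable_densityVector P
  set H : X → ℝ≥0∞ := fun x => weightedProd c (F x) with hH
  have hHm : Measurable H := (measurable_weightedProd c).comp hFm
  have hum : ∀ u : List α, Measurable fun x => (u.map (F x)).prod := fun u =>
    (measurable_list_prod_map u).comp hFm
  have hwd : ∀ R : Measure X, IsFiniteMeasure R → IsExchangeable T α R → R ≪ P →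
      ∀ u : List α, afterWord T R u = R.withDensity fun x => (u.map (F x)).prod :=
    fun R _ hR hRP u => hPex.afterWord_eq_withDensity hR hRP hfib u
  -- Exchangeability moves each averaging word `v` behind `u`, where it becomes the density `∏ a ∈
  -- v, θ a` on the finite measure `afterWord T μ u`.
  have hPu : ∀ u, c u ≠ 0 → afterWord T P u = (afterWord T μ u).withDensity H := by
    intro u hu
    have := hufin u hu
    have hexu := hμ.isExchangeable_afterWord hfib u
    ext B hB
    rw [hfib.afterWord_apply _ _ hB, hP,
      hfib.weightedLaw_apply _ _ (hfib.measurableSet_prepend u hB), withDensity_apply _ hB]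
    simp only [hH, weightedProd]
    rw [lintegral_tsum fun v => ((hum v).const_mul _).aemeasurable]
    refine tsum_congr fun v => ?_
    rw [lintegral_const_mul _ (hum v), ← withDensity_apply _ hB,
      ← hwd _ this hexu (hab u hu) v, ← hfib.afterWord_append, hfib.afterWord_apply _ _ hB,
      ← prepend_append, hμ _ _ List.perm_append_comm _ hB]
  -- The integral of `H` against `P` is at most `(∑ v, c v) * P univ`.
  have hHtop : ∀ᵐ x ∂P, H x ≠ ∞ := by
    refine (ae_lt_top hHm ?_).mono fun x hx => hx.ne
    simp only [hH, weightedProd]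
    rw [lintegral_tsum fun v => ((hum v).const_mul _).aemeasurable]
    refine (lt_of_le_of_lt (ENNReal.tsum_le_tsum (g := fun v => c v * P Set.univ) fun v => ?_)
      (ENNReal.tsum_mul_right.trans_lt
        (ENNReal.mul_lt_top hcs.lt_top (measure_lt_top P Set.univ)))).ne
    rw [lintegral_const_mul _ (hum v)]
    gcongr
    rw [← setLIntegral_univ, ← withDensity_apply _ MeasurableSet.univ,
      ← hwd P hPfin hPex Measure.AbsolutelyContinuous.rfl v,
      hfib.afterWord_apply _ _ MeasurableSet.univ]
    exact measure_mono (Set.subset_univ _)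
  have hrecv : ∀ a : α, ∀ᵐ x ∂μ, visits T (a : Set X) x = 0 ∨ visits T (a : Set X) x = ∞ :=
    fun a => hrec a a.2
  -- On the invariant event `θ a = 0` the letter `a` almost surely never occurs after `u`; but it
  -- occurs in `u`, so recurrence makes it occur again.
  have hFpos : ∀ u, c u ≠ 0 → ∀ a ∈ u, ∀ᵐ x ∂(afterWord T μ u), F x a ≠ 0 := by
    intro u hu a hau
    have := hufin u hu
    set R := afterWord T μ u with hR
    have hexR : IsExchangeable T α R := hμ.isExchangeable_afterWord hfib u
    have hmpR := hexR.measurePreserving hfib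
    have hinv : ∀ᵐ x ∂(R), ∀ n, ∀ a : α, letterDensity T P a (T^[n] x) = letterDensity T P a x :=
      (hab u hu).ae_le (hPex.letterDensity_iterate hfib)
    set E : Set X := {x | F x a = 0} with hE
    have hEm : MeasurableSet E := (measurable_letterDensity P a) (measurableSet_singleton 0)
    have h0 : R (prepend T [a] E) = 0 := by
      rw [← hfib.afterWord_apply _ _ hEm, hwd R this hexR (hab u hu), withDensity_apply _ hEm]
      refine (setLIntegral_congr_fun hEm fun x (hx : F x a = 0) => ?_).trans
        (lintegral_zero (μ := R.restrict E))
      simp [hx]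
    have h1 : ∀ᵐ x ∂(R), x ∈ E → x ∉ (a : Set X) := by
      filter_upwards [measure_eq_zero_iff_ae_notMem.1 h0, hinv] with x hx hxi hxE hxa
      exact hx ⟨hxa, (hxi 1 a).trans hxE⟩
    have h2 : ∀ᵐ x ∂(R), x ∈ E → ∀ n, T^[n] x ∉ (a : Set X) := by
      have : ∀ᵐ x ∂(R), ∀ n, T^[n] x ∈ E → T^[n] x ∉ (a : Set X) := ae_all_iff.2 fun n =>
        (hmpR.iterate n).quasiMeasurePreserving.ae h1
      filter_upwards [this, hinv] with x hx hxi hxE n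
      exact hx n ((hxi n a).trans hxE)
    have h3 : ∀ᵐ x ∂(R), ∃ n, T^[n] x ∈ (a : Set X) := by
      rw [ae_iff]
      simp only [not_exists]
      rw [hR, hfib.afterWord_apply _ _ (hfib.measurableSet_no_visit a),
        measure_eq_zero_iff_ae_notMem]
      filter_upwards [hrecv a] with x hx hxu
      rw [mem_prepend] at hxu
      rcases hx with hx | hx
      · obtain ⟨i, hi, hia⟩ := List.mem_iff_getElem.1 hau
        refine visits_eq_zero_iff.1 hx i ?_
        obtain ⟨b, hb⟩ := hfib.exists_letter (T^[i] x)
        have h1 := hfib.coding_getElem hxu.1 hi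
        rw [hfib.coding_eq hb, hia] at h1
        rwa [← h1]
      · obtain ⟨i, -, hi⟩ := exists_visit_of_visits_eq_top
          (visits_iterate_eq_top hx u.length) 0
        exact hxu.2 i hi
    filter_upwards [h2, h3] with x hx ⟨n, hn⟩ hxE
    exact hx hxE n hn
  have hHpos : ∀ᵐ x ∂P, H x ≠ 0 := by
    rw [ae_iff]
    simp only [not_not]
    refine hPae (hHm (measurableSet_singleton 0)) fun u hu => ?_
    rw [measure_eq_zero_iff_ae_notMem]
    have : ∀ᵐ x ∂(afterWord T μ u), ∀ a, a ∈ u → F x a ≠ 0 := by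
      rw [ae_all_iff]
      intro a
      by_cases hau : a ∈ u
      · filter_upwards [hFpos u hu a hau] with x hx _ using hx
      · exact ae_of_all _ fun x h => (hau h).elim
    filter_upwards [this] with x hx (hxH : H x = 0)
    simp only [hH, weightedProd, ENNReal.tsum_eq_zero] at hxH
    -- Under the law after `u`, the term of `H` indexed by `u` itself is already nonzero.
    have h0 := (mul_eq_zero.1 (hxH u)).resolve_left hu
    rw [List.prod_eq_zero_iff, List.mem_map] at h0
    obtain ⟨a, ha, hxa⟩ := h0
    exact hx a ha hxa
  have hUm := hfib.measurableSet_finitePart (T := T) μ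
  have hPU : P (finitePart T α μ)ᶜ = 0 := by
    refine hPae hUm.compl fun u hu => ?_
    rw [hfib.afterWord_apply _ _ hUm.compl, measure_eq_zero_iff_ae_notMem]
    filter_upwards [hμ.ae_iterate_mem_finitePart hfib hrec hfin] with x hx hxu
    exact (mem_prepend.1 hxu).2 (hx _)
  have hHinv : ∀ᵐ x ∂P, ∀ n, H (T^[n] x) = H x := by
    filter_upwards [hPex.letterDensity_iterate hfib] with x hx n
    have : F (T^[n] x) = F x := funext (hx n)
    simp only [hH, this]
  refine ⟨P, fun θ => (weightedProd c θ)⁻¹, hPfin, hPex, (measurable_weightedProd c).inv,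
    hHpos.mono fun x hx => ENNReal.inv_ne_top.2 hx, ?_⟩
  change μ = P.withDensity fun x => (H x)⁻¹
  have hHim : Measurable fun x => (H x)⁻¹ := hHm.inv
  -- Invariance lets `H` be read after `u`, where the density `H` of `P` relative to `μ` cancels
  -- `H⁻¹`.
  have hM : ∀ u, c u ≠ 0 → ∀ B, MeasurableSet B →
      (P.withDensity fun x => (H x)⁻¹) (prepend T u B) = μ (prepend T u B) := by
    intro u hu B hB
    have hBm := hfib.measurableSet_prepend u hB
    calc (P.withDensity fun x => (H x)⁻¹) (prepend T u B)
        = ∫⁻ x in prepend T u B, (H (T^[u.length] x))⁻¹ ∂P := by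
          rw [withDensity_apply _ hBm]
          exact lintegral_congr_ae (ae_restrict_of_ae (hHinv.mono fun x hx => by simp only [hx]))
      _ = ∫⁻ x in B, (H x)⁻¹ ∂(afterWord T P u) := by
          rw [afterWord, setLIntegral_map hB hHim (hfib.measurable_map.iterate _),
            Measure.restrict_restrict (hfib.measurable_map.iterate _ hB), Set.inter_comm,
            ← prepend_eq_inter]
      _ = ∫⁻ x in B, H x * (H x)⁻¹ ∂(afterWord T μ u) := by
          rw [hPu u hu, setLIntegral_withDensity_eq_setLIntegral_mul _ hHm hHim hB]
          rfl
      _ = ∫⁻ x in B, 1 ∂(afterWord T μ u) := by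
          refine lintegral_congr_ae (ae_restrict_of_ae ?_)
          filter_upwards [(hab u hu).ae_le hHpos, (hab u hu).ae_le hHtop] with x h1 h2
          exact ENNReal.mul_inv_cancel h1 h2
      _ = μ (prepend T u B) := by rw [setLIntegral_one, hfib.afterWord_apply _ _ hB]
  -- The index `none` stands for the complement of the finite part, null for both measures; the
  -- others are the cylinders where `hM` applies.
  have hcov : (⋃ i : Option {u : List α // c u ≠ 0},
      i.elim (finitePart T α μ)ᶜ fun u => prepend T u.1 Set.univ) = Set.univ := by
    refine Set.eq_univ_of_forall fun x => Set.mem_iUnion.2 ?_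
    by_cases hx : x ∈ finitePart T α μ
    · obtain ⟨u, hxu, hu⟩ := hx
      exact ⟨some ⟨u, (hc0 u).2 hu⟩, hxu⟩
    · exact ⟨none, hx⟩
  refine (Measure.ext_iff_of_iUnion_eq_univ hcov).2 fun i => ?_
  rcases i with _ | ⟨u, hu⟩
  · rw [Option.elim_none,
      Measure.restrict_eq_zero.2 (show μ (finitePart T α μ)ᶜ = 0 from mem_ae_iff.1 hfin),
      Measure.restrict_eq_zero.2 (withDensity_absolutelyContinuous _ _ hPU)]
  · ext B hB
    have hum := hfib.measurableSet_prepend u (MeasurableSet.univ (α := X))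
    rw [Option.elim_some, Measure.restrict_apply hB, Measure.restrict_apply hB]
    obtain ⟨C, hC, hBC⟩ := hfib.eq_prepend_of_subset hfull u (hB.inter hum) Set.inter_subset_right
    rw [hBC, hM u hu C hC]

/-- A finite exchangeable measure disintegrates over its conditional letter probabilities into
product measures. -/
theorem IsExchangeable.exists_kernel [Nonempty X] {P : Measure X} [IsFiniteMeasure P]
    (hP : IsExchangeable T α P) (hfib : IsFibredSystem T α) :
    ∃ κ : Kernel (α → ℝ≥0∞) X, IsMarkovKernel κ ∧
      (∀ᵐ θ ∂(P.map (densityVector T α P)), ∀ u : List α,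
        κ θ (prepend T u Set.univ) = (u.map fun a : α => κ θ (a : Set X)).prod) ∧
      ∀ h : (α → ℝ≥0∞) → ℝ≥0∞, Measurable h → ∀ B, MeasurableSet B →
        ∫⁻ x in B, h (densityVector T α P x) ∂P
          = ∫⁻ θ, h θ * κ θ B ∂(P.map (densityVector T α P)) := by
  have := hfib.countable.to_subtype
  set F := densityVector T α P with hF
  have hFm : Measurable F := measurable_densityVector P
  -- The kernel is the conditional law of `x` given `F x`.
  set ρ : Measure ((α → ℝ≥0∞) × X) := P.map fun x => (F x, x) with hρ
  have hFid : Measurable fun x => (F x, x) := hFm.prodMk measurable_id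
  have hfst : ρ.fst = P.map F := Measure.fst_map_prodMk measurable_id
  have hint : ∀ h : (α → ℝ≥0∞) → ℝ≥0∞, Measurable h → ∀ B, MeasurableSet B →
      ∫⁻ x in B, h (F x) ∂P = ∫⁻ θ, h θ * ρ.condKernel θ B ∂(P.map F) := by
    intro h hh B hB
    have hm : Measurable fun p : (α → ℝ≥0∞) × X => h p.1 * B.indicator 1 p.2 :=
      (hh.comp measurable_fst).mul ((measurable_one.indicator hB).comp measurable_snd)
    calc ∫⁻ x in B, h (F x) ∂P = ∫⁻ p, h p.1 * B.indicator 1 p.2 ∂ρ := by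
          rw [hρ, lintegral_map hm hFid, ← lintegral_indicator hB]
          refine lintegral_congr fun x => ?_
          by_cases hx : x ∈ B <;> simp [hx]
      _ = ∫⁻ p, h p.1 * B.indicator 1 p.2 ∂(ρ.fst ⊗ₘ ρ.condKernel) := by
          rw [ρ.disintegrate ρ.condKernel]
      _ = _ := by
          rw [Measure.lintegral_compProd hm, hfst]
          refine lintegral_congr fun θ => ?_
          simp only
          rw [lintegral_const_mul _ (measurable_one.indicator hB), lintegral_indicator_one hB]
  refine ⟨ρ.condKernel, inferInstance, ?_, hint⟩
  -- Since `F` is invariant it can be read after `u`, and the law after `u` has density `(u.map (F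
  -- x)).prod`.
  have hword : ∀ᵐ θ ∂(P.map F), ∀ u : List α,
      ρ.condKernel θ (prepend T u Set.univ) = (u.map θ).prod := by
    rw [ae_all_iff]
    intro u
    have hum := hfib.measurableSet_prepend u (MeasurableSet.univ (α := X))
    have := Measure.isFiniteMeasure_map P F
    refine ae_eq_of_forall_setLIntegral_eq_of_sigmaFinite
      (Kernel.measurable_coe _ hum) (measurable_list_prod_map u) fun S hS _ => ?_
    calc ∫⁻ θ in S, ρ.condKernel θ (prepend T u Set.univ) ∂(P.map F)
        = ∫⁻ x in prepend T u Set.univ, S.indicator 1 (F x) ∂P := by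
          rw [hint _ (measurable_one.indicator hS) _ hum, ← lintegral_indicator hS]
          refine lintegral_congr fun θ => ?_
          by_cases hx : θ ∈ S <;> simp [hx]
      _ = ∫⁻ x in prepend T u Set.univ, S.indicator 1 (F (T^[u.length] x)) ∂P := by
          refine lintegral_congr_ae (ae_restrict_of_ae ?_)
          filter_upwards [hP.letterDensity_iterate hfib] with x hx
          have : F (T^[u.length] x) = F x := funext (hx _)
          rw [this]
      _ = ∫⁻ x, S.indicator 1 (F x) ∂(afterWord T P u) := by
          exact (lintegral_map ((measurable_one.indicator hS).comp hFm)
            (hfib.measurable_map.iterate _)).symm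
      _ = ∫⁻ x, (u.map (F x)).prod * S.indicator 1 (F x) ∂P := by
          rw [hP.afterWord_eq_withDensity hP Measure.AbsolutelyContinuous.rfl hfib u]
          exact lintegral_withDensity_eq_lintegral_mul _ ((measurable_list_prod_map u).comp hFm)
            ((measurable_one.indicator hS).comp hFm)
      _ = ∫⁻ θ in S, (u.map θ).prod ∂(P.map F) := by
          rw [← lintegral_indicator hS, lintegral_map
            ((measurable_list_prod_map u).indicator hS) hFm]
          refine lintegral_congr fun x => ?_
          by_cases hx : F x ∈ S <;> simp [hx]
  filter_upwards [hword] with θ hθ u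
  rw [hθ u]
  congr 2
  funext a
  -- One-letter words identify `θ a` with the kernel's mass of `a`.
  have := hθ [a]
  simpa [prepend_cons] using this.symm

end Mixture

/-- A recurrent exchangeable measure whose finite part has full measure is a mixture of product
measures. -/
theorem IsExchangeable.isMixtureOf {X : Type*} {T : X → X} {α : Set (Set X)} [MeasurableSpace X]
    [StandardBorelSpace X] {μ : Measure X} (hμ : IsExchangeable T α μ)
    (hfib : IsFibredSystem T α) (hfull : IsFull T α) (hrec : IsRecurrent T α μ)
    (hfin : ∀ᵐ x ∂μ, x ∈ finitePart T α μ) : IsMixtureOf (IsProductMeasure T α) μ := by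
  have := hfib.countable.to_subtype
  rcases isEmpty_or_nonempty X with hX | hX
  -- An empty space carries no probability measure, so the parameter space must be empty.
  · refine ⟨PEmpty, ⊤, 0, 0, inferInstance, fun ω => ω.elim, fun B _ => ?_⟩
    simp [Set.eq_empty_of_isEmpty]
  obtain ⟨P, h, hPfin, hPex, hhm, hhtop, hμP⟩ :=
    hμ.exists_eq_withDensity hfib hfull hrec hfin
  obtain ⟨κ, hκ, hprod, hint⟩ := hPex.exists_kernel hfib
  set F := densityVector T α P
  have hFm : Measurable F := measurable_densityVector P
  -- Multiplicativity holds only for almost every `θ`, while a mixture asks for it at every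
  -- parameter; hence `G` becomes the parameter space.
  set G : Set (α → ℝ≥0∞) := {θ | ∀ u : List α,
    κ θ (prepend T u Set.univ) = (u.map fun a : α => κ θ (a : Set X)).prod} with hG
  have hGm : MeasurableSet G := by
    simp only [hG, Set.ofPred_forall]
    refine MeasurableSet.iInter fun u => measurableSet_eq_fun
      (Kernel.measurable_coe _ (hfib.measurableSet_prepend u MeasurableSet.univ)) ?_
    exact (measurable_list_prod_map u).comp (measurable_pi_iff.2 fun a =>
      Kernel.measurable_coe _ (hfib.measurableSet a a.2))
  have := Measure.isFiniteMeasure_map P F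
  set ν := (P.map F).withDensity h with hν
  have hνσ : SigmaFinite ν := by
    refine SigmaFinite.withDensity_of_ne_top ?_
    exact (ae_map_iff hFm.aemeasurable (hhm (measurableSet_singleton ∞).compl)).2 hhtop
  have hνG : ∀ᵐ θ ∂ν, θ ∈ G := (withDensity_absolutelyContinuous _ _).ae_le hprod
  refine ⟨G, inferInstance, ν.comap Subtype.val, κ.comap Subtype.val measurable_subtype_coe,
    ?_, fun θ => ?_, fun B hB => ?_⟩
  · refine SigmaFinite.of_map _ measurable_subtype_coe.aemeasurable ?_
    rw [map_comap_subtype_coe hGm]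
    infer_instance
  · rw [Kernel.comap_apply]
    exact isProductMeasure_of_prepend θ.2
  · simp only [Kernel.comap_apply]
    rw [lintegral_subtype_comap hGm (f := fun θ => κ θ B),
      Measure.restrict_eq_self_of_ae_mem hνG, hν,
      lintegral_withDensity_eq_lintegral_mul _ hhm (Kernel.measurable_coe _ hB)]
    conv_lhs => rw [hμP, withDensity_apply _ hB, hint h hhm B hB]
    rfl

end Fibred

theorem proposition2p2 {X : Type*} [MeasurableSpace X] [StandardBorelSpace X]
    (T : X → X) (α : Set (Set X))
    (hfib : Fibred.IsFibredSystem T α) (hfull : Fibred.IsFull T α)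
    (μ : Measure X) [SigmaFinite μ]
    (hinv : Fibred.IsInvariant (Fibred.exchangeableRel T α) μ) :
    (Fibred.IsTopologicallySigmaFinite (Fibred.cylinderTopology T α) μ →
      Fibred.IsRecurrent T α μ →
        Fibred.IsMixtureOf (Fibred.IsProductMeasure T α) μ) ∧
    (Fibred.IsLocallyFinite (Fibred.cylinderTopology T α) μ →
      Fibred.IsRecurrent T α μ ∧
        Fibred.IsMixtureOf (Fibred.IsProductMeasure T α) μ) := by
  have hμ := hfib.isExchangeable hfull hinv
  refine ⟨fun ⟨Y, _, hY0, hY⟩ hrec => ?_, fun hloc => ?_⟩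
  · refine hμ.isMixtureOf hfib hfull hrec ?_
    filter_upwards [compl_mem_ae_iff.2 hY0] with x hx
    exact hfib.subset_finitePart hY0 hY (not_not.1 hx)
  · have hfin := Set.univ_subset_iff.1 (hfib.subset_finitePart (by simp) hloc)
    have hrec := hμ.isRecurrent hfib hfin
    exact ⟨hrec, hμ.isMixtureOf hfib hfull hrec (ae_of_all _ fun x => hfin ▸ Set.mem_univ x)⟩
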